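/- Let $\mathbb{F}_q$ be a finite field and let $1\le k\le \ell\le m$ be integers. For every $n\ge \ell$ let $F_n$ be a field extension of $\mathbb{F}_q$ of degree $n$, let $\alpha_1^{(n)},\dots,\alpha_\ell^{(n)}\in F_n$ be linearly independent over $\mathbb{F}_q$ with span $A_n$, and let $W_n=A_n\oplus F_n$ (of dimension $\ell+n$). For every $n\ge 2\ell$ fix an $\mathbb{F}_q$-linear isomorphism $F_n\cong W_{n-\ell}$, used as an identification. For subspaces $U,V$ put $d(U,V)=\dim U+\dim V-2\dim(U\cap V)$, and for $U\subseteq W_n$ put $U|_{F}=\{v_2:(v_1,v_2)\in U\}\subseteq F_n$. *Codes.* A linearized polynomial is one of the form $\sum_{i} a_i x^{q^i}$. Let $\mathcal{K}_n=\mathcal{K}[\ell+n,\ell,k]$ be the set of all subspaces $\mathcal{E}(f)=\mathrm{span}\{(\alpha^{(n)}_j,f(\alpha^{(n)}_j)):1\le j\le \ell\}\subseteq W_n$, where $f$ runs over the linearized polynomials over $F_n$ of degree at most $q^{k-1}$. Define $\mathcal{C}_n=\mathcal{C}[\ell+n,\ell,k]$ recursively by $\mathcal{C}_n=\mathcal{K}_n$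 if $n<2\ell$, and $\mathcal{C}_n=\mathcal{K}_n\cup\{\{0\}\oplus V' : V'\in\mathcal{C}_{n-\ell}\}$ if $n\ge 2\ell$, where $V'\subseteq W_{n-\ell}\cong F_n$. *Decoders.* The Kötter–Kschischang decoder $\mathcal{D}^{\mathcal{K}}_n$ works as follows on a subspace $U\subseteq W_n$ of dimension $r$. With $\tau=\lceil (r+k)/2\rceil$, it chooses linearized polynomials $(Q_x,Q_y)\neq(0,0)$ over $F_n$ of degrees less than $q^{\tau}$ and $q^{\tau-k+1}$ respectively (with $Q_y=0$ if $\tau-k+1\le 0$), such that $Q_x(u_1)+Q_y(u_2)=0$ for all $(u_1,u_2)\in U$. It then chooses a linearized polynomial $f$ of degree at most $q^{k-1}$ with $Q_x(x)+Q_y(f(x))=0$ identically, and returns $\mathcal{E}(f)$ if $d(U,\mathcal{E}(f))<\ell-k+1$. It returns the failure symbol "?" if a step is impossible or the last inequality fails. Given subroutines $D_n$ that map subspaces of $W_n$ to subspaces of $W_n$ or "?", the recursive decoder $\mathcal{D}_n$ does the following on input $U\subseteq W_n$. If $D_n(U)\ne$ "?", it returns $D_n(U)$. If $D_n(U)=$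 "?" and $n\ge 2\ell$, it computes $V'=\mathcal{D}_{n-\ell}(U|_F)$, where $U|_F\subseteq F_n\cong W_{n-\ell}$, and returns $\{0\}\oplus V'$ if $V'\neq$ "?". Otherwise it returns "?". **Theorem.** Let $V\in\mathcal{C}_m$ be sent and let a subspace $U\subseteq W_m$ be received, with $\dim U=\ell-\kappa+\gamma$ and $\dim(U\cap V)=\ell-\kappa$, where $\kappa,\gamma\ge 0$ are integers with $\kappa+\gamma<\ell-k+1$. Then the recursive decoder with the Kötter–Kschischang decoders as subroutines, $D_n=\mathcal{D}^{\mathcal{K}}_n$, returns $V$ on input $U$. The same holds with any other decoders of the codes $\mathcal{K}_n$ with this radius as subroutines (such as the Silva–Kschischang–Kötter decoder, made to return "?" on failure), that is, for any $D_n$ such that, for all $n\ge\ell$ and all $U'\subseteq W_n$, $D_n(U')=V'$ whenever $V'\in\mathcal{K}_n$ and $d(U',V')<\ell-k+1$, and $D_n(U')=$ "?" if there is no such $V'$. -/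

import Mathlib

open Polynomial

universe u v

/-- The linearized polynomials `∑_{i<k} aᵢ x^(q^i)` over `F`, that is (for `k ≥ 1`) those of degree
at most `q^(k-1)`; for `k = 0` only the zero polynomial. -/
def linearizedPolys (F : Type v) [Field F] (q k : ℕ) : Set F[X] :=
  {f | ∃ a : ℕ → F, f = ∑ i ∈ Finset.range k, C (a i) * X ^ (q ^ i)}

/-- The distance `d(U, V) = dim U + dim V - 2 dim (U ∩ V)` between two subspaces. -/
noncomputable def subspaceDist {Fq : Type u} [Field Fq] {W : Type v} [AddCommGroup W] [Module Fq W]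
    (U V : Submodule Fq W) : ℤ :=
  (Module.finrank Fq U : ℤ) + Module.finrank Fq V - 2 * Module.finrank Fq (U ⊓ V : Submodule Fq W)

/-- The choices made in the code construction over the base field `Fq`, with `ℓ ≥ 1`:
for every `m ≥ ℓ` an extension field `F m` of degree `m` and linearly independent
`α₁, …, α_ℓ ∈ F m`, and for every `m ≥ 2ℓ` a linear identification of `F m` (a space of dimension
`m = ℓ + (m - ℓ)`) with the ambient space `⟨A⟩ ⊕ F (m - ℓ)` of the code used in the recursive
step. The values at smaller `m` are never used. -/
structure CodeSetup (Fq : Type u) [Field Fq] (ℓ : ℕ) where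
  ell_pos : 0 < ℓ
  F : ℕ → Type v
  [instField : ∀ m, Field (F m)]
  [instAlgebra : ∀ m, Algebra Fq (F m)]
  finrank_F : ∀ m, ℓ ≤ m → Module.finrank Fq (F m) = m
  α : ∀ m, Fin ℓ → F m
  α_indep : ∀ m, ℓ ≤ m → LinearIndependent Fq (α m)
  ident : ∀ m, 2 * ℓ ≤ m →
    F m ≃ₗ[Fq] (Submodule.span Fq (Set.range (α (m - ℓ))) × F (m - ℓ))

namespace CodeSetup

attribute [instance] CodeSetup.instField CodeSetup.instAlgebra

variable {Fq : Type u} [Field Fq] {ℓ : ℕ} (S : CodeSetup.{u, v} Fq ℓ)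

/-- `⟨A⟩`, the span of `α₁, …, α_ℓ`. -/
abbrev A (m : ℕ) : Submodule Fq (S.F m) := Submodule.span Fq (Set.range (S.α m))

/-- The ambient space `W = ⟨A⟩ ⊕ F` of dimension `ℓ + m`. -/
abbrev W (m : ℕ) : Type v := S.A m × S.F m

/-- `ℰ(f)`, the span of the vectors `(αⱼ, f(αⱼ))`. -/
noncomputable def encode (m : ℕ) (f : (S.F m)[X]) : Submodule Fq (S.W m) :=
  Submodule.span Fq (Set.range fun j : Fin ℓ =>
    ((⟨S.α m j, Submodule.subset_span ⟨j, rfl⟩⟩ : S.A m), f.eval (S.α m j)))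

/-- The code `𝒦[ℓ+m, ℓ, k]`. -/
def codeK (k m : ℕ) : Set (Submodule Fq (S.W m)) :=
  S.encode m '' linearizedPolys (S.F m) (Nat.card Fq) k

/-- For a subspace `U` of the smaller ambient space `⟨A⟩ ⊕ F (m - ℓ)`, identified with `F m`:
the subspace `{0} ⊕ U` of `⟨A⟩ ⊕ F m`. -/
noncomputable def lift (m : ℕ) (h : 2 * ℓ ≤ m) (U : Submodule Fq (S.W (m - ℓ))) :
    Submodule Fq (S.W m) :=
  (⊥ : Submodule Fq (S.A m)).prod (U.map (S.ident m h).symm.toLinearMap)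

/-- The projection `U|_F = {v₂ : (v₁, v₂) ∈ U}`, as a subspace of the smaller ambient space
`⟨A⟩ ⊕ F (m - ℓ)`, identified with `F m`. -/
noncomputable def proj (m : ℕ) (h : 2 * ℓ ≤ m) (U : Submodule Fq (S.W m)) :
    Submodule Fq (S.W (m - ℓ)) :=
  (U.map (LinearMap.snd Fq (S.A m) (S.F m))).map (S.ident m h).toLinearMap

/-- The code `𝒞[ℓ+m, ℓ, k]` with all design parameters `h` equal to `0`:
`𝒦[ℓ+m, ℓ, k]` if `m < 2ℓ`, and otherwise `𝒦[ℓ+m, ℓ, k] ∪ ℬ`, where `ℬ` consists of the spaces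
`{0} ⊕ U_σ` with `U_σ` ranging over `𝒞[m, ℓ, k]`. -/
noncomputable def code (k m : ℕ) : Set (Submodule Fq (S.W m)) :=
  have _hℓ := S.ell_pos
  if h : 2 * ℓ ≤ m then S.codeK k m ∪ S.lift m h '' code k (m - ℓ) else S.codeK k m
termination_by m
decreasing_by omega

/-- Interpolation step for the received space `U`, of dimension `r`, with `τ = ⌈(r + k) / 2⌉`:
`(Q_x, Q_y) ≠ (0, 0)` are linearized polynomials of degrees less than `q^τ` and `q^(τ-k+1)`
such that `Q_x(x) + Q_y(y)` vanishes on `U`. -/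
def IsInterpolation (k m : ℕ) (U : Submodule Fq (S.W m)) (Q : (S.F m)[X] × (S.F m)[X]) : Prop :=
  let τ := (Module.finrank Fq U + k + 1) / 2
  Q.1 ∈ linearizedPolys (S.F m) (Nat.card Fq) τ ∧
  Q.2 ∈ linearizedPolys (S.F m) (Nat.card Fq) (τ + 1 - k) ∧
  Q ≠ 0 ∧
  ∀ u ∈ U, Q.1.eval (u.1 : S.F m) + Q.2.eval u.2 = 0

open Classical in
/-- The interpolation step: some solution of the homogeneous linear system. -/
noncomputable def interpolate (k m : ℕ) (U : Submodule Fq (S.W m)) :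
    Option ((S.F m)[X] × (S.F m)[X]) :=
  if h : ∃ Q, S.IsInterpolation k m U Q then some h.choose else none

open Classical in
/-- The factorization (division) step: a linearized message polynomial `f` with
`Q_x(x) + Q_y(f(x)) = 0`, if there is one. -/
noncomputable def factor (k m : ℕ) (Q : (S.F m)[X] × (S.F m)[X]) : Option (S.F m)[X] :=
  if h : ∃ f ∈ linearizedPolys (S.F m) (Nat.card Fq) k, Q.1 + Q.2.comp f = 0
  then some h.choose else none

open Classical in
/-- The Kötter–Kschischang decoder for `𝒦[ℓ+m, ℓ, k]`: interpolate, factor, re-encode. The failure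
symbol `none` is returned if a step fails, or if the result is not within the decoding radius. -/
noncomputable def decoderK (k m : ℕ) (U : Submodule Fq (S.W m)) : Option (Submodule Fq (S.W m)) :=
  match (S.interpolate k m U).bind (S.factor k m) with
  | none => none
  | some f =>
    if subspaceDist U (S.encode m f) < (ℓ : ℤ) - k + 1 then some (S.encode m f) else none

/-- `D` decodes `𝒦[ℓ+m, ℓ, k]` up to distance less than `ℓ - k + 1`: it returns any codeword within
this radius of its input, and the failure symbol `none` if there is no such codeword. -/
structure IsDecoderK (k m : ℕ) (D : Submodule Fq (S.W m) → Option (Submodule Fq (S.W m))) :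
    Prop where
  recovers : ∀ U, ∀ V ∈ S.codeK k m, subspaceDist U V < (ℓ : ℤ) - k + 1 → D U = some V
  fails : ∀ U, (∀ V ∈ S.codeK k m, ¬ subspaceDist U V < (ℓ : ℤ) - k + 1) → D U = none

/-- The recursive decoder, with subroutines `D m` for the codes `𝒦[ℓ+m, ℓ, k]`. If the subroutine
fails and `m ≥ 2ℓ`, it decodes `U|_F` recursively to some `V'` and returns `{0} ⊕ V'`. -/
noncomputable def decoder
    (D : ∀ m, Submodule Fq (S.W m) → Option (Submodule Fq (S.W m)))
    (m : ℕ) (U : Submodule Fq (S.W m)) : Option (Submodule Fq (S.W m)) :=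
  match D m U with
  | some Z => some Z
  | none =>
    if h : 2 * ℓ ≤ m then (decoder D (m - ℓ) (S.proj m h U)).map (S.lift m h) else none
termination_by m
decreasing_by
  have := S.ell_pos
  omega

end CodeSetup

/-!
Every codeword has dimension `ℓ`, so the hypotheses on `κ` and `γ` say that
`d(U, V) = κ + γ < ℓ - k + 1`. The theorem follows from two facts.

*The Kötter–Kschischang decoder decodes `𝒦` up to this radius* (`isDecoderK_decoderK`). Let
`d(U, ℰ(f)) ≤ ℓ - k`, `r = dim U` and `τ = ⌈(r + k) / 2⌉`; then `dim (U ∩ ℰ(f)) ≥ τ ≥ k`. An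
interpolation pair exists, because there are `2τ + 1 - k > r` unknown coefficients for `r` linear
equations (`exists_isInterpolation`). For any such pair, `Q_x + Q_y ∘ f` has degree at most
`q^(τ-1)` and vanishes at the `q^(dim (U ∩ ℰ(f))) ≥ q^τ` first components of `U ∩ ℰ(f)`, so it is
zero (`IsInterpolation.add_comp_eq_zero`). Since `Q_y` is nonzero and additive, no other linearized
polynomial `g` satisfies `Q_x + Q_y ∘ g = 0` (`IsInterpolation.eq_of_add_comp_eq_zero`), and the
factorization step has to return `f`.

*The recursive decoder works with any such subroutines* (`decoder_eq_some`), by induction on `m`.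
A codeword `V = {0} ⊕ V'` meets every `ℰ(f)` trivially, so that `U ∩ V` and `U ∩ ℰ(f)` are
independent in `U`; hence if `U` is within the radius of `V`, it is within the radius of no `ℰ(f)`,
and the subroutine fails (`not_subspaceDist_lt_of_disjoint`). The map `(v₁, v₂) ↦ v₂` is injective
on `V` and hence does not increase the distance of `U` to `V` (`subspaceDist_map_le`), so that the
induction hypothesis applies to `U|_F` and `V'`.
-/

/-! ### Linearized polynomials -/

section Linearized

variable {Fq : Type u} [Field Fq] {F : Type v} [Field F]

theorem natDegree_le_of_mem_linearizedPolys {q k : ℕ} (hq : 0 < q) {f : F[X]}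
    (hf : f ∈ linearizedPolys F q k) : f.natDegree ≤ q ^ (k - 1) := by
  obtain ⟨a, rfl⟩ := hf
  refine natDegree_sum_le_of_forall_le _ _ fun i hi => ?_
  rw [Finset.mem_range] at hi
  exact (natDegree_C_mul_X_pow_le _ _).trans (Nat.pow_le_pow_right hq (by omega))

theorem linearCombination_mem_linearizedPolys (q t : ℕ) (a : Fin t → F) :
    Fintype.linearCombination F (fun i : Fin t => (X ^ (q ^ (i : ℕ)) : F[X])) a ∈
      linearizedPolys F q t := by
  refine ⟨fun i => if h : i < t then a ⟨i, h⟩ else 0, ?_⟩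
  rw [Finset.sum_range, Fintype.linearCombination_apply]
  simp [smul_eq_C_mul]

theorem linearIndependent_X_pow_pow {q : ℕ} (hq : 1 < q) (t : ℕ) :
    LinearIndependent F (fun i : Fin t => (X ^ (q ^ (i : ℕ)) : F[X])) := by
  have h := (basisMonomials F).linearIndependent.comp (fun i : Fin t => q ^ (i : ℕ))
    fun i j hij => Fin.ext (Nat.pow_right_injective hq hij)
  convert h using 2 with i
  simp [X_pow_eq_monomial]

/-- Linearized polynomials act `Fq`-linearly on every algebra over `F`. It is needed for the action
on `F` (evaluation) and for that on `F[X]` (composition). -/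
theorem exists_linearMap_eq_aeval [Finite Fq] [Algebra Fq F] {R : Type*} [CommRing R]
    [Algebra Fq R] [Algebra F R] [IsScalarTower Fq F R] {k : ℕ} {f : F[X]}
    (hf : f ∈ linearizedPolys F (Nat.card Fq) k) :
    ∃ L : R →ₗ[Fq] R, ∀ x, L x = aeval x f := by
  have := Fintype.ofFinite Fq
  obtain ⟨a, rfl⟩ := hf
  refine ⟨∑ i ∈ Finset.range k, (LinearMap.mulLeft Fq (algebraMap F R (a i))).comp
    ((FiniteField.frobeniusAlgHom Fq R) ^ i).toLinearMap, fun x => ?_⟩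
  simp [LinearMap.sum_apply, FiniteField.coe_frobeniusAlgHom, pow_iterate,
    Nat.card_eq_fintype_card]

end Linearized

/-! ### The subspace distance -/

section Distance

variable {Fq : Type u} [Field Fq] {W : Type v} [AddCommGroup W] [Module Fq W]
  [FiniteDimensional Fq W]

/-- If `V` and `E` have dimension `n` and meet trivially, a space cannot be closer than `n` to both
of them. -/
theorem not_subspaceDist_lt_of_disjoint {U V E : Submodule Fq W} {n : ℕ}
    (hV : Module.finrank Fq V = n) (hE : Module.finrank Fq E = n) (h : Disjoint V E)
    {r : ℤ} (hr : r ≤ n) (hUV : subspaceDist U V < r) : ¬ subspaceDist U E < r := by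
  have h1 := Submodule.finrank_sup_add_finrank_inf_eq (U ⊓ V) (U ⊓ E)
  have h2 : (U ⊓ V) ⊓ (U ⊓ E) = ⊥ :=
    (h.mono inf_le_right inf_le_right).eq_bot
  have h3 : Module.finrank Fq ((U ⊓ V) ⊔ (U ⊓ E) : Submodule Fq W) ≤ Module.finrank Fq U :=
    Submodule.finrank_mono (sup_le inf_le_left inf_le_left)
  rw [h2, finrank_bot] at h1
  simp only [subspaceDist] at *
  omega

/-- A linear map that is injective on `V` does not increase the distance to `V`. -/
theorem subspaceDist_map_le {W' : Type*} [AddCommGroup W'] [Module Fq W']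
    [FiniteDimensional Fq W'] (g : W →ₗ[Fq] W') (U V : Submodule Fq W)
    (hg : Set.InjOn g V) : subspaceDist (U.map g) (V.map g) ≤ subspaceDist U V := by
  -- `g` preserves the dimensions of subspaces of `V`
  have key : ∀ Z ≤ V, Module.finrank Fq (Z.map g) = Module.finrank Fq Z := fun Z hZ => by
    have hi : Function.Injective (g.domRestrict Z) := fun x y hxy =>
      Subtype.ext (hg (hZ x.2) (hZ y.2) hxy)
    rw [← LinearMap.finrank_range_of_inj hi, LinearMap.range_domRestrict]
  have h1 := key V le_rfl
  have h2 := key (U ⊓ V) inf_le_right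
  have h3 := Submodule.finrank_mono (Submodule.map_inf_le g (p := U) (q := V))
  have h4 := Submodule.finrank_map_le g U
  simp only [subspaceDist]
  omega

end Distance

namespace CodeSetup

variable {Fq : Type u} [Field Fq] {ℓ : ℕ} (S : CodeSetup.{u, v} Fq ℓ)

/-! ### The spaces `ℰ(f)` -/

theorem finiteDimensional_F {m : ℕ} (hm : ℓ ≤ m) : FiniteDimensional Fq (S.F m) :=
  Module.finite_of_finrank_pos (by have := S.ell_pos; have := S.finrank_F m hm; omega)

theorem snd_eq_eval_of_mem_encode [Finite Fq] {k m : ℕ} {f : (S.F m)[X]}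
    (hf : f ∈ linearizedPolys (S.F m) (Nat.card Fq) k) {u : S.W m} (hu : u ∈ S.encode m f) :
    u.2 = f.eval (u.1 : S.F m) := by
  obtain ⟨L, hL⟩ := exists_linearMap_eq_aeval (R := S.F m) hf
  simp only [coe_aeval_eq_eval] at hL
  have h : S.encode m f ≤ LinearMap.ker (LinearMap.snd Fq (S.A m) (S.F m) -
      L ∘ₗ (S.A m).subtype ∘ₗ LinearMap.fst Fq (S.A m) (S.F m)) := by
    rw [encode, Submodule.span_le]
    rintro _ ⟨j, rfl⟩
    simp [hL]
  have := h hu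
  simpa [hL, sub_eq_zero] using this

theorem finrank_encode {m : ℕ} (hm : ℓ ≤ m) (f : (S.F m)[X]) :
    Module.finrank Fq (S.encode m f) = ℓ := by
  have h : LinearIndependent Fq (fun j : Fin ℓ =>
      ((⟨S.α m j, Submodule.subset_span ⟨j, rfl⟩⟩ : S.A m), f.eval (S.α m j))) :=
    LinearIndependent.of_comp ((S.A m).subtype ∘ₗ LinearMap.fst Fq (S.A m) (S.F m))
      (S.α_indep m hm)
  rw [encode, finrank_span_eq_card h, Fintype.card_fin]

/-! ### The Kötter–Kschischang decoder -/

/-- There are more unknown coefficients, `2τ + 1 - k`, than equations, one for each vector of a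
basis of `U`. For `τ < k` there are only `τ` unknowns, which may be too few; `k ≤ dim U` excludes
this case. -/
theorem exists_isInterpolation [Finite Fq] {k m : ℕ} (hm : ℓ ≤ m) (U : Submodule Fq (S.W m))
    (hkU : k ≤ Module.finrank Fq U) : ∃ Q, S.IsInterpolation k m U Q := by
  have := S.finiteDimensional_F hm
  set r := Module.finrank Fq U with hr
  set τ := (r + k + 1) / 2 with hτ
  have : Module.Free Fq U := Module.Free.of_divisionRing Fq U
  let b := Module.finBasis Fq U
  let P (t : ℕ) : (Fin t → S.F m) →ₗ[S.F m] (S.F m)[X] :=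
    Fintype.linearCombination (S.F m) fun i : Fin t => (X ^ (Nat.card Fq ^ (i : ℕ)) : (S.F m)[X])
  have hP (t : ℕ) : Function.Injective (P t) :=
    (linearIndependent_X_pow_pow Finite.one_lt_card t).fintypeLinearCombination_injective
  let Φ : (Fin τ → S.F m) × (Fin (τ + 1 - k) → S.F m) →ₗ[S.F m] (Fin r → S.F m) :=
    LinearMap.pi fun i =>
      (leval ((b i : S.W m).1 : S.F m) ∘ₗ P τ).coprod (leval (b i : S.W m).2 ∘ₗ P (τ + 1 - k))
  obtain ⟨⟨x, y⟩, hxy, h0⟩ := Submodule.exists_mem_ne_zero_of_ne_bot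
    (Φ.ker_ne_bot_of_finrank_lt (by
      simp only [Module.finrank_prod, Module.finrank_fin_fun]
      omega))
  have hx : P τ x ∈ linearizedPolys (S.F m) (Nat.card Fq) τ :=
    linearCombination_mem_linearizedPolys _ _ _
  have hy : P (τ + 1 - k) y ∈ linearizedPolys (S.F m) (Nat.card Fq) (τ + 1 - k) :=
    linearCombination_mem_linearizedPolys _ _ _
  refine ⟨(P τ x, P (τ + 1 - k) y), hx, hy, fun h => h0 ?_, fun u hu => ?_⟩
  · rw [Prod.mk_eq_zero] at h ⊢
    exact ⟨hP _ (h.1.trans (map_zero _).symm), hP _ (h.2.trans (map_zero _).symm)⟩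
  · -- the relation holds on the basis, and both polynomials act linearly
    obtain ⟨L₁, hL₁⟩ := exists_linearMap_eq_aeval (R := S.F m) hx
    obtain ⟨L₂, hL₂⟩ := exists_linearMap_eq_aeval (R := S.F m) hy
    simp only [coe_aeval_eq_eval] at hL₁ hL₂
    have hT : ((L₁ ∘ₗ (S.A m).subtype).coprod L₂) ∘ₗ U.subtype = 0 := by
      refine b.ext fun i => ?_
      have h := congrFun (LinearMap.mem_ker.mp hxy) i
      simpa [Φ, hL₁, hL₂] using h
    simpa [hL₁, hL₂] using LinearMap.congr_fun hT ⟨u, hu⟩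

variable {S}

/-- The polynomial `Q_x + Q_y ∘ f` vanishes at the first components of `U ∩ ℰ(f)`, which are too
many for its degree. -/
theorem IsInterpolation.add_comp_eq_zero [Finite Fq] {k m : ℕ} (hk : 1 ≤ k) (hm : ℓ ≤ m)
    {U : Submodule Fq (S.W m)} {Q : (S.F m)[X] × (S.F m)[X]} (hQ : S.IsInterpolation k m U Q)
    (hkU : k ≤ Module.finrank Fq U)
    {f : (S.F m)[X]} (hf : f ∈ linearizedPolys (S.F m) (Nat.card Fq) k)
    (hdim : Module.finrank Fq U + k ≤
      2 * Module.finrank Fq (U ⊓ S.encode m f : Submodule Fq (S.W m))) :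
    Q.1 + Q.2.comp f = 0 := by
  have := S.finiteDimensional_F hm
  have : Finite (S.F m) := Module.finite_of_finite Fq
  have := Fintype.ofFinite (U ⊓ S.encode m f : Submodule Fq (S.W m))
  obtain ⟨h1, h2, -, h4⟩ := hQ
  set r := Module.finrank Fq U
  set τ := (r + k + 1) / 2
  have hq : 1 < Nat.card Fq := Finite.one_lt_card
  refine eq_zero_of_natDegree_lt_card_of_eval_eq_zero _
    (f := fun u : (U ⊓ S.encode m f : Submodule Fq (S.W m)) => ((u : S.W m).1 : S.F m))
    (fun u v huv => ?_) (fun u => ?_) ?_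
  · have hu := S.snd_eq_eval_of_mem_encode hf u.2.2
    have hv := S.snd_eq_eval_of_mem_encode hf v.2.2
    have huv' : ((u : S.W m).1 : S.F m) = ((v : S.W m).1 : S.F m) := huv
    exact Subtype.ext (Prod.ext (Subtype.ext huv') (by rw [hu, hv, huv']))
  · rw [eval_add, eval_comp, ← S.snd_eq_eval_of_mem_encode hf u.2.2]
    exact h4 u u.2.1
  · have hd : (Q.1 + Q.2.comp f).natDegree ≤ Nat.card Fq ^ (τ - 1) := by
      refine natDegree_add_le_of_degree_le
        (natDegree_le_of_mem_linearizedPolys (by omega) h1) ?_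
      rw [natDegree_comp]
      refine (Nat.mul_le_mul (natDegree_le_of_mem_linearizedPolys (by omega) h2)
        (natDegree_le_of_mem_linearizedPolys (by omega) hf)).trans ?_
      rw [← pow_add]
      exact Nat.pow_le_pow_right (by omega) (by omega)
    refine hd.trans_lt ?_
    rw [← Nat.card_eq_fintype_card,
      Module.natCard_eq_pow_finrank (K := Fq) (V := (U ⊓ S.encode m f : Submodule Fq (S.W m)))]
    exact Nat.pow_lt_pow_right hq (by omega)

/-- The difference of two solutions is a root of the nonzero additive polynomial `Q_y` under
composition, hence a constant. -/
theorem IsInterpolation.eq_of_add_comp_eq_zero [Finite Fq] {k m : ℕ}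
    {U : Submodule Fq (S.W m)} {Q : (S.F m)[X] × (S.F m)[X]} (hQ : S.IsInterpolation k m U Q)
    {f g : (S.F m)[X]} (hf : f ∈ linearizedPolys (S.F m) (Nat.card Fq) k)
    (hg : g ∈ linearizedPolys (S.F m) (Nat.card Fq) k)
    (hQf : Q.1 + Q.2.comp f = 0) (hQg : Q.1 + Q.2.comp g = 0) : f = g := by
  obtain ⟨-, h2, h3, -⟩ := hQ
  have hQ2 : Q.2 ≠ 0 := fun h => h3 (Prod.ext (by simpa [h] using hQf) h)
  obtain ⟨L, hL⟩ := exists_linearMap_eq_aeval (R := (S.F m)[X]) h2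
  have hfg : Q.2.comp (f - g) = 0 := by
    rw [comp_eq_aeval, ← hL, map_sub, hL, hL, ← comp_eq_aeval, ← comp_eq_aeval, sub_eq_zero]
    exact add_left_cancel (hQf.trans hQg.symm)
  have hc : f - g = C ((f - g).coeff 0) := ((comp_eq_zero_iff.mp hfg).resolve_left hQ2).2
  -- linearized polynomials have no constant term, so a constant difference is zero
  have h0 : ∀ p ∈ linearizedPolys (S.F m) (Nat.card Fq) k, p.coeff 0 = 0 := by
    intro p hp
    obtain ⟨L', hL'⟩ := exists_linearMap_eq_aeval (R := S.F m) hp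
    rw [coeff_zero_eq_eval_zero, ← coe_aeval_eq_eval, ← hL', map_zero]
  rw [coeff_sub, h0 f hf, h0 g hg, sub_zero, C_0] at hc
  exact sub_eq_zero.mp hc

variable (S)

theorem isDecoderK_decoderK [Finite Fq] {k m : ℕ} (hk : 1 ≤ k) (hm : ℓ ≤ m) :
    S.IsDecoderK k m (S.decoderK k m) where
  recovers := by
    rintro U _ ⟨f, hf, rfl⟩ hd
    have := S.finiteDimensional_F hm
    have hE := S.finrank_encode hm f
    have hle : Module.finrank Fq (U ⊓ S.encode m f : Submodule Fq (S.W m)) ≤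
        Module.finrank Fq U := Submodule.finrank_mono inf_le_left
    have hd' := hd
    rw [subspaceDist, hE] at hd'
    have hdim : Module.finrank Fq U + k ≤
      2 * Module.finrank Fq (U ⊓ S.encode m f : Submodule Fq (S.W m)) := by omega
    have hkU : k ≤ Module.finrank Fq U := by omega
    have hi := S.exists_isInterpolation hm U hkU
    have hQ := hi.choose_spec
    have hz := hQ.add_comp_eq_zero hk hm hkU hf hdim
    have hfac : ∃ g ∈ linearizedPolys (S.F m) (Nat.card Fq) k,
        hi.choose.1 + hi.choose.2.comp g = 0 := ⟨f, hf, hz⟩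
    have heq : hfac.choose = f :=
      hQ.eq_of_add_comp_eq_zero hfac.choose_spec.1 hf hfac.choose_spec.2 hz
    have hstep : (S.interpolate k m U).bind (S.factor k m) = some f := by
      rw [interpolate, dif_pos hi, Option.bind_some, factor, dif_pos hfac, heq]
    rw [decoderK, hstep]
    exact if_pos hd
  fails := by
    intro U hU
    rw [decoderK]
    split
    · rfl
    · rename_i f hf
      obtain ⟨Q, -, hQf⟩ := Option.bind_eq_some_iff.mp hf
      rw [factor] at hQf
      split at hQf
      · rename_i h
        rw [Option.some.injEq] at hQf
        exact if_neg (hU _ ⟨f, hQf ▸ h.choose_spec.1, rfl⟩)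
      · simp at hQf

/-! ### The recursive decoder -/

/-- The projection to `F m`, followed by the identification with the smaller ambient space. -/
noncomputable def projMap (m : ℕ) (h : 2 * ℓ ≤ m) : S.W m →ₗ[Fq] S.W (m - ℓ) :=
  (S.ident m h).toLinearMap ∘ₗ LinearMap.snd Fq (S.A m) (S.F m)

theorem proj_eq_map (m : ℕ) (h : 2 * ℓ ≤ m) (U : Submodule Fq (S.W m)) :
    S.proj m h U = U.map (S.projMap m h) := by
  rw [proj, projMap, Submodule.map_comp]

theorem map_projMap_lift (m : ℕ) (h : 2 * ℓ ≤ m) (V : Submodule Fq (S.W (m - ℓ))) :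
    (S.lift m h V).map (S.projMap m h) = V := by
  rw [projMap, lift, Submodule.map_comp, Submodule.prod_map_snd, ← Submodule.map_comp]
  simp

theorem injOn_projMap_lift (m : ℕ) (h : 2 * ℓ ≤ m) (V : Submodule Fq (S.W (m - ℓ))) :
    Set.InjOn (S.projMap m h) (S.lift m h V) := by
  intro x hx y hy hxy
  have hx1 : x.1 = 0 := (Submodule.mem_prod.mp hx).1
  have hy1 : y.1 = 0 := (Submodule.mem_prod.mp hy).1
  exact Prod.ext (hx1.trans hy1.symm) ((S.ident m h).injective hxy)

theorem finrank_lift {m : ℕ} (h : 2 * ℓ ≤ m) (V : Submodule Fq (S.W (m - ℓ))) :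
    Module.finrank Fq (S.lift m h V) = Module.finrank Fq V := by
  have hi : Function.Injective ((S.projMap m h).domRestrict (S.lift m h V)) := fun x y hxy =>
    Subtype.ext (S.injOn_projMap_lift m h V x.2 y.2 hxy)
  rw [← LinearMap.finrank_range_of_inj hi, LinearMap.range_domRestrict, map_projMap_lift]

theorem disjoint_lift_encode [Finite Fq] {k m : ℕ} (h : 2 * ℓ ≤ m)
    (V : Submodule Fq (S.W (m - ℓ))) {f : (S.F m)[X]}
    (hf : f ∈ linearizedPolys (S.F m) (Nat.card Fq) k) :
    Disjoint (S.lift m h V) (S.encode m f) := by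
  rw [Submodule.disjoint_def]
  intro x hx hxE
  have hx1 : x.1 = 0 := (Submodule.mem_prod.mp hx).1
  have hx2 := S.snd_eq_eval_of_mem_encode hf hxE
  obtain ⟨L, hL⟩ := exists_linearMap_eq_aeval (R := S.F m) hf
  rw [hx1, Submodule.coe_zero, ← coe_aeval_eq_eval, ← hL, map_zero] at hx2
  exact Prod.ext hx1 hx2

theorem finrank_of_mem_code {k : ℕ} {m : ℕ} (hm : ℓ ≤ m) {V : Submodule Fq (S.W m)}
    (hV : V ∈ S.code k m) : Module.finrank Fq V = ℓ := by
  induction m using Nat.strong_induction_on with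
  | _ m ih =>
    have hℓ := S.ell_pos
    rw [code] at hV
    split at hV
    · rename_i h
      rcases hV with ⟨f, -, rfl⟩ | ⟨V', hV', rfl⟩
      · exact S.finrank_encode hm f
      · rw [S.finrank_lift h]
        exact ih (m - ℓ) (by omega) (by omega) hV'
    · obtain ⟨f, -, rfl⟩ := hV
      exact S.finrank_encode hm f

theorem decoder_eq_some [Finite Fq] {k : ℕ} (hk : 1 ≤ k)
    {D : ∀ m, Submodule Fq (S.W m) → Option (Submodule Fq (S.W m))}
    (hD : ∀ m, ℓ ≤ m → S.IsDecoderK k m (D m)) {m : ℕ} (hm : ℓ ≤ m)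
    {U V : Submodule Fq (S.W m)} (hV : V ∈ S.code k m)
    (hd : subspaceDist U V < (ℓ : ℤ) - k + 1) : S.decoder D m U = some V := by
  induction m using Nat.strong_induction_on with
  | _ m ih =>
    have hℓ := S.ell_pos
    have hK : V ∈ S.codeK k m → S.decoder D m U = some V := fun hVK => by
      rw [decoder, (hD m hm).recovers U V hVK hd]
    rw [code] at hV
    split at hV
    · rename_i h
      rcases hV with hVK | ⟨V', hV', rfl⟩
      · exact hK hVK
      · have := S.finiteDimensional_F hm
        have hm' : ℓ ≤ m - ℓ := by omega
        have := S.finiteDimensional_F hm'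
        have hnone : D m U = none := by
          refine (hD m hm).fails U ?_
          rintro _ ⟨f, hf, rfl⟩
          refine not_subspaceDist_lt_of_disjoint (n := ℓ) ?_ (S.finrank_encode hm f)
            (S.disjoint_lift_encode h V' hf) (by omega) hd
          rw [S.finrank_lift h, S.finrank_of_mem_code hm' hV']
        have hrec : S.decoder D (m - ℓ) (S.proj m h U) = some V' := by
          refine ih (m - ℓ) (by omega) hm' hV' (lt_of_le_of_lt ?_ hd)
          have := subspaceDist_map_le (S.projMap m h) U _ (S.injOn_projMap_lift m h V')
          rwa [map_projMap_lift, ← proj_eq_map] at this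
        rw [decoder, hnone]
        simp only [dif_pos h, hrec, Option.map_some]
    · exact hK hV

end CodeSetup

theorem mainTheorem3 {Fq : Type u} [Field Fq] [Finite Fq] {ℓ k m : ℕ}
    (hk : 1 ≤ k) (hkℓ : k ≤ ℓ) (hℓm : ℓ ≤ m)
    (S : CodeSetup.{u, v} Fq ℓ)
    (V : Submodule Fq (S.W m)) (hV : V ∈ S.code k m)
    (U : Submodule Fq (S.W m)) (κ γ : ℕ)
    (hU : (Module.finrank Fq U : ℤ) = ℓ - κ + γ)
    (hUV : (Module.finrank Fq (U ⊓ V : Submodule Fq (S.W m)) : ℤ) = ℓ - κ)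
    (hκγ : (κ : ℤ) + γ < ℓ - k + 1) :
    S.decoder (S.decoderK k) m U = some V ∧
    ∀ D : ∀ m' : ℕ, Submodule Fq (S.W m') → Option (Submodule Fq (S.W m')),
      (∀ m', ℓ ≤ m' → S.IsDecoderK k m' (D m')) → S.decoder D m U = some V := by
  have hd : subspaceDist U V < (ℓ : ℤ) - k + 1 := by
    rw [subspaceDist, hU, hUV, S.finrank_of_mem_code hℓm hV]
    linarith
  exact ⟨S.decoder_eq_some hk (fun _ hm' => S.isDecoderK_decoderK hk hm') hℓm hV hd,
    fun D hD => S.decoder_eq_some hk hD hℓm hV hd⟩
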